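/- Fix an integer $s\ge 1$. For every $n\ge 0$ let $v=v^{(n)}$ and $x=x^{(n)}$ be vectors in $\mathbb R^n$, and let $b_n\ge 1$ be a bucket size: the coordinates $1,\dots,n$ are split into buckets of $b_n$ consecutive coordinates, the last one possibly shorter ($b_n\ge n$ means a single bucket). For a coordinate $i$ let $\beta_i$ be the minimum of $v_j$ over the bucket of $i$, let $\alpha_i$ be the maximum minus the minimum of $v_j$ over that bucket, and let $u_i=(v_i-\beta_i)/\alpha_i\in[0,1]$ (with $u_i=0$ if $\alpha_i=0$). The stochastic uniform quantization of $v$, with grid points $0,\frac1s,\dots,\frac ss$, is $$Q(v_i)=\alpha_i\left(\frac{\lfloor s u_i\rfloor}{s}+\frac{\xi_i}{s}\right)+\beta_i ,$$ where $\xi_1,\dots,\xi_n$ are independent random variables and $\xi_i$ is Bernoulli with $\mathbb P(\xi_i=1)=s u_i-\lfloor s u_i\rfloor$ and $\mathbb P(\xi_i=0)=1-(s u_i-\lfloor s u_i\rfloor)$. (The vectors and the rounding variables may change with $n$, the variables for different $n$ may live on different probability spaces, and nothing is assumed about their joint law across different $n$.) Put $s_n=\bigl(\sum_{i=1}^n \operatorname{Var}[Q(v_i)x_i]\bigr)^{1/2}$.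 Theorem. Suppose that there is a constant $M$ such that $|v_i|\le M$ and $|x_i|\le M$ for all $n$ and all $i\in\{1,\dots,n\}$, and that $\lim_{n\to\infty}s_n=\infty$. Then $$\sum_{i=1}^n Q(v_i)x_i=\sum_{i=1}^n v_ix_i+\varepsilon_n$$ where, for every $n$, $\varepsilon_n$ is an integrable random variable with $\mathbb E[\varepsilon_n]=0$, and $$\frac{1}{s_n}\,\varepsilon_n\ \xrightarrow{\ \mathcal D\ }\ N(0,1)\qquad(n\to\infty).$$ -/

import Mathlib

open MeasureTheory ProbabilityTheory Filter
open scoped Topology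

namespace UniformQuantization

noncomputable section

/-- The bucket of the coordinate `i`, when the `n` coordinates are split into buckets of `b`
consecutive coordinates (the last bucket may be shorter). If `n ≤ b` there is only one bucket. -/
def bucket {n : ℕ} (b : ℕ) (i : Fin n) : Finset (Fin n) :=
  Finset.univ.filter fun j => (j : ℕ) / b = (i : ℕ) / b

theorem bucket_nonempty {n : ℕ} (b : ℕ) (i : Fin n) : (bucket b i).Nonempty :=
  ⟨i, by simp [bucket]⟩

/-- The shift `β = min v_j` of the linear scaling, the minimum being over the bucket of `i`. -/
def shift {n : ℕ} (b : ℕ) (v : Fin n → ℝ) (i : Fin n) : ℝ :=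
  (bucket b i).inf' (bucket_nonempty b i) v

/-- The factor `α = max v_j - min v_j` of the linear scaling, over the bucket of `i`. -/
def scale {n : ℕ} (b : ℕ) (v : Fin n → ℝ) (i : Fin n) : ℝ :=
  (bucket b i).sup' (bucket_nonempty b i) v - (bucket b i).inf' (bucket_nonempty b i) v

/-- The linearly scaled coordinate `(v_i - β) / α`, which lies in `[0, 1]`. On a bucket where `v`
is constant, `α = 0` and the scaled coordinate is `0`. -/
def scaled {n : ℕ} (b : ℕ) (v : Fin n → ℝ) (i : Fin n) : ℝ :=
  (v i - shift b v i) / scale b v i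

/-- The rounding probability `k = s u - ⌊s u⌋` of a scaled coordinate `u`. -/
def roundProb (s : ℕ) (u : ℝ) : unitInterval :=
  ⟨u * s - ⌊u * s⌋, by
    rw [Int.self_sub_floor]
    exact ⟨Int.fract_nonneg _, (Int.fract_lt_one _).le⟩⟩

/-- The quantization of a scaled coordinate `u` to the grid `{k / s}`, where `r` is the value of
the rounding variable. -/
def unitQuantize (s : ℕ) (u r : ℝ) : ℝ :=
  (⌊u * s⌋ : ℝ) / s + r / s

/-- The `i`-th coordinate of the quantized vector, `Q(v)_i = α Q̂((v_i - β) / α) + β`, where `r` is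
the value of the rounding variable of this coordinate. -/
def quantize {n : ℕ} (s b : ℕ) (v : Fin n → ℝ) (r : ℝ) (i : Fin n) : ℝ :=
  scale b v i * unitQuantize s (scaled b v i) r + shift b v i

/-- The random variables `ξ i` are rounding variables for the stochastic uniform quantization of
`v`: they are independent, and `ξ i` takes the value `1` with probability `k_i = roundProb s u_i`
and the value `0` with probability `1 - k_i`, where `u_i` is the scaled `i`-th coordinate. -/
structure IsStochasticRounding {Ω : Type*} [MeasurableSpace Ω] {n : ℕ} (s b : ℕ) (v : Fin n → ℝ)
    (ξ : Fin n → Ω → ℝ) (P : Measure Ω) : Prop where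
  indep : iIndepFun ξ P
  law : ∀ i, HasLaw (ξ i) (bernoulliMeasure (1 : ℝ) 0 (roundProb s (scaled b v i))) P

/-- The random variable `Q(v)_i`. -/
def stochQuantize {Ω : Type*} {n : ℕ} (s b : ℕ) (v : Fin n → ℝ) (ξ : Fin n → Ω → ℝ)
    (i : Fin n) (ω : Ω) : ℝ :=
  quantize s b v (ξ i ω) i

/-- The standard deviation scale `(∑ i, Var[Q(v)_i x_i]) ^ (1/2)`. -/
def totalStd {Ω : Type*} [MeasurableSpace Ω] {n : ℕ} (s b : ℕ) (v x : Fin n → ℝ)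
    (ξ : Fin n → Ω → ℝ) (P : Measure Ω) : ℝ :=
  Real.sqrt (∑ i, variance (fun ω => stochQuantize s b v ξ i ω * x i) P)

end

end UniformQuantization

/-! Each rounding probability is the fractional part of s u_i, so rounding is unbiased and the error
is a sum of independent centered terms (α_i/s) x_i (ξ_i - k_i), all bounded by C = 2M². The claim is
thus a central limit theorem for bounded rows with total variance σ_n² → ∞, proved by Lévy's
continuity theorem. At u = t/σ_n, `norm_charFun_sub_exp_le` puts each factor within 2C|u|³ Var_i of
its Gaussian counterpart. By `norm_prod_sub_prod_le_sum` these errors add up to at most 2C|t|³/σ_n,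
which tends to 0. Only the law of each row enters. -/

/-- If two families lie in the closed unit disc, their products differ by at most the sum of the
termwise differences. -/
theorem norm_prod_sub_prod_le_sum {ι : Type*} (t : Finset ι) (f g : ι → ℂ)
    (hf : ∀ i ∈ t, ‖f i‖ ≤ 1) (hg : ∀ i ∈ t, ‖g i‖ ≤ 1) :
    ‖∏ i ∈ t, f i - ∏ i ∈ t, g i‖ ≤ ∑ i ∈ t, ‖f i - g i‖ := by
  classical
  induction t using Finset.induction_on with
  | empty => simp
  | insert a t ha ih =>
    rw [Finset.prod_insert ha, Finset.prod_insert ha, Finset.sum_insert ha]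
    have hg' : ‖∏ i ∈ t, g i‖ ≤ 1 := by
      rw [norm_prod]
      exact Finset.prod_le_one (fun _ _ => norm_nonneg _)
        fun i hi => hg i (Finset.mem_insert_of_mem hi)
    have ih' := ih (fun i hi => hf i (Finset.mem_insert_of_mem hi))
      fun i hi => hg i (Finset.mem_insert_of_mem hi)
    have hfa := hf a (Finset.mem_insert_self a t)
    calc ‖f a * ∏ i ∈ t, f i - g a * ∏ i ∈ t, g i‖
        = ‖(f a - g a) * ∏ i ∈ t, g i + f a * (∏ i ∈ t, f i - ∏ i ∈ t, g i)‖ := by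
          congr 1; ring
      _ ≤ ‖f a - g a‖ * ‖∏ i ∈ t, g i‖ + ‖f a‖ * ‖∏ i ∈ t, f i - ∏ i ∈ t, g i‖ := by
          grw [norm_add_le, norm_mul, norm_mul]
      _ ≤ ‖f a - g a‖ * 1 + 1 * ‖∏ i ∈ t, f i - ∏ i ∈ t, g i‖ := by gcongr
      _ ≤ ‖f a - g a‖ + ∑ i ∈ t, ‖f i - g i‖ := by linarith

/-! ### Characteristic function of one bounded variable -/

/-- Second order Taylor estimate for `exp (i y)`. -/
theorem norm_exp_mul_I_sub_le {y : ℝ} (hy : |y| ≤ 1) :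
    ‖Complex.exp (y * Complex.I) - (1 + y * Complex.I - y ^ 2 / 2)‖ ≤ |y| ^ 3 := by
  have hn : ‖(y : ℂ) * Complex.I‖ = |y| := by simp
  have h := Complex.exp_bound (x := (y : ℂ) * Complex.I) (hn.trans_le hy) (n := 3) (by norm_num)
  rw [hn] at h
  have hs : ∑ m ∈ Finset.range 3, ((y : ℂ) * Complex.I) ^ m / (m.factorial : ℂ)
      = 1 + y * Complex.I - y ^ 2 / 2 := by
    simp [Finset.sum_range_succ, mul_pow]
    ring
  rw [hs] at h
  -- The discarded factor is 4/(3!·3) = 2/9.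
  refine h.trans (mul_le_of_le_one_right (by positivity) ?_)
  norm_num [Nat.factorial]

/-- The characteristic function of a centered bounded random variable is close to that of the
Gaussian with the same variance. -/
theorem norm_charFun_sub_exp_le {Ω : Type*} [MeasurableSpace Ω] {P : Measure Ω}
    [IsProbabilityMeasure P] {X : Ω → ℝ} (hX : AEMeasurable X P) {C : ℝ}
    (hC : ∀ᵐ ω ∂P, |X ω| ≤ C) (h0 : ∫ ω, X ω ∂P = 0) {u : ℝ} (hu : |u| * C ≤ 1) :
    ‖charFun (P.map X) u - Complex.exp (-(u ^ 2 * Var[X; P] / 2 : ℝ))‖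
      ≤ 2 * C * |u| ^ 3 * Var[X; P] := by
  have hC0 : 0 ≤ C := by
    obtain ⟨ω, hω⟩ := hC.exists
    exact (abs_nonneg _).trans hω
  have hvar := variance_of_integral_eq_zero hX h0
  have hXi : Integrable X P := Integrable.of_bound hX.aestronglyMeasurable C hC
  have hsq : ∀ᵐ ω ∂P, X ω ^ 2 ≤ C ^ 2 := by
    filter_upwards [hC] with ω hω
    exact sq_le_sq' (abs_le.1 hω).1 (abs_le.1 hω).2
  have hX2 : Integrable (fun ω => X ω ^ 2) P := by
    refine Integrable.of_bound (hX.pow_const 2).aestronglyMeasurable (C ^ 2) ?_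
    filter_upwards [hsq] with ω hω
    rwa [Real.norm_of_nonneg (sq_nonneg _)]
  have hv0 : 0 ≤ Var[X; P] := variance_nonneg _ _
  have hv1 : Var[X; P] ≤ C ^ 2 := by
    rw [hvar]
    calc ∫ ω, X ω ^ 2 ∂P ≤ ∫ _, C ^ 2 ∂P := integral_mono_ae hX2 (integrable_const _) hsq
      _ = C ^ 2 := by simp
  have hexp : Integrable (fun ω => Complex.exp ((u * X ω : ℝ) * Complex.I)) P := by
    refine Integrable.of_bound (C := 1) ?_ (ae_of_all _ fun ω => ?_)
    · have : AEMeasurable (fun ω => Complex.exp ((u * X ω : ℝ) * Complex.I)) P := by fun_prop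
      exact this.aestronglyMeasurable
    · rw [Complex.norm_exp_ofReal_mul_I]
  have hT : ∫ ω, (1 + ((u * X ω : ℝ) : ℂ) * Complex.I - ((u * X ω : ℝ) : ℂ) ^ 2 / 2) ∂P
      = 1 - ((u ^ 2 * Var[X; P] / 2 : ℝ) : ℂ) := by
    have e : ∀ ω, (1 + ((u * X ω : ℝ) : ℂ) * Complex.I - ((u * X ω : ℝ) : ℂ) ^ 2 / 2)
        = (1 + (X ω : ℂ) * (u * Complex.I)) - ((X ω ^ 2 : ℝ) : ℂ) * (u ^ 2 / 2) := by
      intro ω; push_cast; ring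
    simp_rw [e]
    rw [integral_sub, integral_add, integral_mul_const, integral_mul_const, integral_complex_ofReal,
      integral_complex_ofReal, h0, hvar]
    · simp; ring
    · exact integrable_const _
    · exact hXi.ofReal.mul_const _
    · exact (integrable_const _).add (hXi.ofReal.mul_const _)
    · exact hX2.ofReal.mul_const _
  have hTi : Integrable
      (fun ω => (1 + ((u * X ω : ℝ) : ℂ) * Complex.I - ((u * X ω : ℝ) : ℂ) ^ 2 / 2)) P := by
    have e : ∀ ω, (1 + ((u * X ω : ℝ) : ℂ) * Complex.I - ((u * X ω : ℝ) : ℂ) ^ 2 / 2)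
        = (1 + (X ω : ℂ) * (u * Complex.I)) - ((X ω ^ 2 : ℝ) : ℂ) * (u ^ 2 / 2) := by
      intro ω; push_cast; ring
    simp_rw [e]
    exact ((integrable_const _).add (hXi.ofReal.mul_const _)).sub (hX2.ofReal.mul_const _)
  -- One factor |X| of the cubic remainder is traded for C, leaving a multiple of X²: the error is
  -- then proportional to the variance and can be summed.
  have h1 : ‖charFun (P.map X) u - (1 - ((u ^ 2 * Var[X; P] / 2 : ℝ) : ℂ))‖
      ≤ C * |u| ^ 3 * Var[X; P] := by
    have hφ : charFun (P.map X) u = ∫ ω, Complex.exp ((u * X ω : ℝ) * Complex.I) ∂P := by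
      rw [charFun_apply_real, integral_map hX (by fun_prop)]
      simp
    rw [hφ, ← hT, ← integral_sub hexp hTi, hvar, ← integral_const_mul]
    refine norm_integral_le_of_norm_le (hX2.const_mul _) ?_
    filter_upwards [hC] with ω hω
    have hy : |u * X ω| ≤ 1 := by
      rw [abs_mul]
      exact (mul_le_mul_of_nonneg_left hω (abs_nonneg u)).trans hu
    refine (norm_exp_mul_I_sub_le hy).trans ?_
    calc |u * X ω| ^ 3 = |X ω| * (|u| ^ 3 * X ω ^ 2) := by
          rw [abs_mul, ← sq_abs (X ω)]; ring
      _ ≤ C * (|u| ^ 3 * X ω ^ 2) := by gcongr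
      _ = C * |u| ^ 3 * X ω ^ 2 := by ring
  have hw0 : 0 ≤ u ^ 2 * Var[X; P] / 2 := by positivity
  have huC : u ^ 2 * C ^ 2 ≤ 1 := by
    rw [← sq_abs u, ← mul_pow]
    exact pow_le_one₀ (by positivity) hu
  have hw1 : u ^ 2 * Var[X; P] / 2 ≤ 1 := by
    have := mul_le_mul_of_nonneg_left hv1 (sq_nonneg u)
    linarith
  -- With w = u² Var/2, the remainder is at most w². One factor Var is bounded by C², and |u| C ≤ 1
  -- absorbs the excess.
  have h2 : ‖(1 - ((u ^ 2 * Var[X; P] / 2 : ℝ) : ℂ))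
      - Complex.exp (-(u ^ 2 * Var[X; P] / 2 : ℝ))‖ ≤ C * |u| ^ 3 * Var[X; P] := by
    rw [norm_sub_rev]
    have h := Complex.norm_exp_sub_one_sub_id_le (x := -((u ^ 2 * Var[X; P] / 2 : ℝ) : ℂ))
      (by rw [norm_neg, Complex.norm_real, Real.norm_of_nonneg hw0]; exact hw1)
    rw [norm_neg, Complex.norm_real, Real.norm_of_nonneg hw0] at h
    rw [show (1 - ((u ^ 2 * Var[X; P] / 2 : ℝ) : ℂ)) = 1 + -((u ^ 2 * Var[X; P] / 2 : ℝ) : ℂ) by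
      ring, ← sub_sub]
    refine h.trans ?_
    have hk : 0 ≤ C * |u| ^ 3 * Var[X; P] := by positivity
    calc (u ^ 2 * Var[X; P] / 2) ^ 2
        = |u| ^ 4 * Var[X; P] * Var[X; P] / 4 := by rw [← sq_abs u]; ring
      _ ≤ |u| ^ 4 * Var[X; P] * C ^ 2 / 4 := by gcongr
      _ = (|u| * C) * (C * |u| ^ 3 * Var[X; P]) / 4 := by ring
      _ ≤ 1 * (C * |u| ^ 3 * Var[X; P]) / 4 := by gcongr
      _ ≤ C * |u| ^ 3 * Var[X; P] := by linarith
  calc _ = ‖(charFun (P.map X) u - (1 - ((u ^ 2 * Var[X; P] / 2 : ℝ) : ℂ)))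
        + ((1 - ((u ^ 2 * Var[X; P] / 2 : ℝ) : ℂ))
          - Complex.exp (-(u ^ 2 * Var[X; P] / 2 : ℝ)))‖ := by
        congr 1; push_cast; ring
    _ ≤ C * |u| ^ 3 * Var[X; P] + C * |u| ^ 3 * Var[X; P] :=
        (norm_add_le _ _).trans (add_le_add h1 h2)
    _ = _ := by ring

/-! ### Central limit theorem for bounded arrays -/

/-- **Central limit theorem** for triangular arrays of uniformly bounded, centered, rowwise
independent random variables whose row variances tend to infinity. -/
theorem tendstoInDistribution_sum_of_bounded {Ω : ℕ → Type*} [∀ n, MeasurableSpace (Ω n)]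
    {P : ∀ n, Measure (Ω n)} [∀ n, IsProbabilityMeasure (P n)] {ι : ℕ → Type*}
    [∀ n, Fintype (ι n)] {X : ∀ n, ι n → Ω n → ℝ} (hX : ∀ n i, AEMeasurable (X n i) (P n))
    (hindep : ∀ n, iIndepFun (X n) (P n)) (h0 : ∀ n i, ∫ ω, X n i ω ∂(P n) = 0) {C : ℝ}
    (hC : ∀ n i, ∀ᵐ ω ∂(P n), |X n i ω| ≤ C)
    (hlim : Tendsto (fun n => √(∑ i, Var[X n i; P n])) atTop atTop) :
    TendstoInDistribution (fun n ω => 1 / √(∑ i, Var[X n i; P n]) * ∑ i, X n i ω)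
      atTop (id : ℝ → ℝ) P (gaussianReal 0 1) where
  forall_aemeasurable n := by
    have := hX n
    fun_prop
  tendsto := by
    refine ProbabilityMeasure.tendsto_iff_tendsto_charFun.2 fun t => ?_
    simp only [ProbabilityMeasure.coe_mk, Measure.map_id]
    set σ : ℕ → ℝ := fun n => √(∑ i, Var[X n i; P n]) with hσ
    have hinv : Tendsto (fun n => (σ n)⁻¹) atTop (𝓝 0) := tendsto_inv_atTop_zero.comp hlim
    have hsmall : Tendsto (fun n => |1 / σ n * t| * C) atTop (𝓝 0) := by
      simpa using ((hinv.mul_const t).abs).mul_const C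
    have hrate : Tendsto (fun n => 2 * C * |t| ^ 3 * (σ n)⁻¹) atTop (𝓝 0) := by
      simpa using hinv.const_mul (2 * C * |t| ^ 3)
    rw [tendsto_iff_norm_sub_tendsto_zero]
    refine squeeze_zero' (Eventually.of_forall fun _ => norm_nonneg _) ?_ hrate
    -- For large n, σ_n is nonzero and |t/σ_n| C ≤ 1, the range of the Taylor estimate.
    filter_upwards [hlim.eventually_gt_atTop 0, hsmall.eventually_le_const zero_lt_one]
      with n hpos hle
    have hsq : ∑ i, Var[X n i; P n] = σ n ^ 2 :=
      (Real.sq_sqrt (Finset.sum_nonneg fun i _ => variance_nonneg _ _)).symm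
    -- The Gaussian is split into one factor per summand, with matching variance.
    have hG : charFun (gaussianReal 0 1) t
        = ∏ i, Complex.exp (-((1 / σ n * t) ^ 2 * Var[X n i; P n] / 2 : ℝ)) := by
      rw [← Complex.exp_sum, charFun_gaussianReal]
      congr 1
      rw [Finset.sum_neg_distrib, ← Complex.ofReal_sum, ← Finset.sum_div, ← Finset.mul_sum, hsq,
        show (1 / σ n * t) ^ 2 * σ n ^ 2 / 2 = t ^ 2 / 2 by field_simp]
      simp
    have hφ : charFun ((P n).map fun ω => 1 / σ n * ∑ i, X n i ω) t
        = ∏ i, charFun ((P n).map (X n i)) (1 / σ n * t) := by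
      rw [charFun_map_mul_comp (Finset.aemeasurable_fun_sum _ fun i _ => hX n i),
        (hindep n).charFun_map_fun_sum_eq_prod (hX n), Finset.prod_apply]
    rw [hG, hφ]
    refine (norm_prod_sub_prod_le_sum _ _ _ (fun i _ => ?_) fun i _ => ?_).trans ?_
    · have := Measure.isProbabilityMeasure_map (hX n i)
      exact norm_charFun_le_one _
    · rw [← Complex.ofReal_neg, Complex.norm_exp_ofReal, Real.exp_le_one_iff, neg_nonpos]
      have := variance_nonneg (X n i) (P n)
      positivity
    · calc _ ≤ ∑ i, 2 * C * |1 / σ n * t| ^ 3 * Var[X n i; P n] :=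
            Finset.sum_le_sum fun i _ =>
              norm_charFun_sub_exp_le (hX n i) (hC n i) (h0 n i) hle
        _ = 2 * C * |t| ^ 3 * (σ n)⁻¹ := by
            rw [← Finset.mul_sum, hsq, abs_mul, abs_of_pos (one_div_pos.2 hpos)]
            field_simp

/-! ### The quantization error -/

namespace UniformQuantization

theorem mem_bucket_self {n : ℕ} (b : ℕ) (i : Fin n) : i ∈ bucket b i := by
  simp [bucket]

theorem abs_scale_le {n : ℕ} (b : ℕ) {v : Fin n → ℝ} {M : ℝ} (hv : ∀ i, |v i| ≤ M) (i : Fin n) :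
    |scale b v i| ≤ 2 * M := by
  have h1 : (bucket b i).sup' (bucket_nonempty b i) v ≤ M :=
    Finset.sup'_le _ _ fun j _ => (abs_le.1 (hv j)).2
  have h2 : -M ≤ (bucket b i).inf' (bucket_nonempty b i) v :=
    Finset.le_inf' _ _ fun j _ => (abs_le.1 (hv j)).1
  have h3 := Finset.inf'_le v (mem_bucket_self b i)
  have h4 := Finset.le_sup' v (mem_bucket_self b i)
  rw [scale, abs_of_nonneg (by linarith)]
  linarith

theorem scale_mul_scaled_add_shift {n : ℕ} (b : ℕ) (v : Fin n → ℝ) (i : Fin n) :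
    scale b v i * scaled b v i + shift b v i = v i := by
  by_cases h : scale b v i = 0
  -- On a constant bucket the minimum and maximum both equal v_i, so the value of the quotient by 0
  -- is irrelevant.
  · have h3 := Finset.inf'_le v (mem_bucket_self b i)
    have h4 := Finset.le_sup' v (mem_bucket_self b i)
    rw [h, zero_mul, zero_add]
    rw [scale] at h
    rw [shift]
    linarith
  · rw [scaled]
    field_simp
    ring

/-- The quantization error is a multiple of the centered rounding variable. -/
theorem quantize_sub {n s : ℕ} (hs : 1 ≤ s) (b : ℕ) (v : Fin n → ℝ) (r : ℝ) (i : Fin n) :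
    quantize s b v r i - v i = scale b v i / s * (r - roundProb s (scaled b v i)) := by
  have hs' : (s : ℝ) ≠ 0 := by positivity
  have h := scale_mul_scaled_add_shift b v i
  simp only [quantize, unitQuantize, roundProb]
  field_simp
  linear_combination s * h

variable {Ω : Type*} [MeasurableSpace Ω] {P : Measure Ω} {n s b : ℕ} {v : Fin n → ℝ}
  {ξ : Fin n → Ω → ℝ}

theorem IsStochasticRounding.integral_eq (h : IsStochasticRounding s b v ξ P) (i : Fin n) :
    ∫ ω, ξ i ω ∂P = roundProb s (scaled b v i) := by
  rw [(h.law i).integral_eq, integral_bernoulliMeasure]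
  simp

theorem IsStochasticRounding.ae_mem_Icc (h : IsStochasticRounding s b v ξ P) (i : Fin n) :
    ∀ᵐ ω ∂P, ξ i ω ∈ Set.Icc (0 : ℝ) 1 := by
  rw [(h.law i).ae_iff (p := fun x => x ∈ Set.Icc (0 : ℝ) 1) measurableSet_Icc.mem, ae_iff]
  change bernoulliMeasure (1 : ℝ) 0 _ (Set.Icc (0 : ℝ) 1)ᶜ = 0
  exact bernoulliMeasure_apply_of_notMem_of_notMem _ measurableSet_Icc.compl (by simp) (by simp)

theorem IsStochasticRounding.ae_abs_sub_le (h : IsStochasticRounding s b v ξ P) (i : Fin n) :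
    ∀ᵐ ω ∂P, |ξ i ω - roundProb s (scaled b v i)| ≤ 1 := by
  filter_upwards [h.ae_mem_Icc i] with ω hω
  have := (roundProb s (scaled b v i)).2
  rw [abs_le]
  constructor <;> linarith [hω.1, hω.2, this.1, this.2]

theorem IsStochasticRounding.integrable [IsProbabilityMeasure P]
    (h : IsStochasticRounding s b v ξ P) (i : Fin n) : Integrable (ξ i) P := by
  refine Integrable.of_bound (h.law i).aemeasurable.aestronglyMeasurable 1 ?_
  filter_upwards [h.ae_mem_Icc i] with ω hω
  rw [Real.norm_of_nonneg hω.1]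
  exact hω.2

/-- The contribution of the `i`-th coordinate to the error of the quantized inner product. -/
noncomputable def coordError (s b : ℕ) (v x : Fin n → ℝ) (ξ : Fin n → Ω → ℝ) (i : Fin n) (ω : Ω) :
    ℝ :=
  scale b v i / s * x i * (ξ i ω - roundProb s (scaled b v i))

omit [MeasurableSpace Ω] in
theorem stochQuantize_mul_sub (hs : 1 ≤ s) (x : Fin n → ℝ) (i : Fin n) (ω : Ω) :
    stochQuantize s b v ξ i ω * x i - v i * x i = coordError s b v x ξ i ω := by
  rw [← sub_mul, stochQuantize, quantize_sub hs, coordError]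
  ring

theorem aemeasurable_coordError (h : IsStochasticRounding s b v ξ P) (x : Fin n → ℝ) (i : Fin n) :
    AEMeasurable (coordError s b v x ξ i) P := by
  have := (h.law i).aemeasurable
  unfold coordError
  fun_prop

variable [IsProbabilityMeasure P]

theorem integrable_coordError (h : IsStochasticRounding s b v ξ P) (x : Fin n → ℝ) (i : Fin n) :
    Integrable (coordError s b v x ξ i) P :=
  ((h.integrable i).sub (integrable_const _)).const_mul _

theorem integral_coordError (h : IsStochasticRounding s b v ξ P) (x : Fin n → ℝ) (i : Fin n) :
    ∫ ω, coordError s b v x ξ i ω ∂P = 0 := by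
  simp only [coordError]
  rw [integral_const_mul, integral_sub (h.integrable i) (integrable_const _), h.integral_eq]
  simp

/-- The two variables differ by the constant v_i x_i, so `totalStd` is exactly the normalization of
the limit theorem. -/
theorem variance_coordError (hs : 1 ≤ s) (h : IsStochasticRounding s b v ξ P) (x : Fin n → ℝ)
    (i : Fin n) :
    Var[coordError s b v x ξ i; P] = Var[fun ω => stochQuantize s b v ξ i ω * x i; P] := by
  have e : (fun ω => stochQuantize s b v ξ i ω * x i)
      = fun ω => coordError s b v x ξ i ω + v i * x i := by
    ext ω
    rw [← stochQuantize_mul_sub hs]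
    ring
  rw [e, variance_add_const (aemeasurable_coordError h x i).aestronglyMeasurable]

omit [IsProbabilityMeasure P] in
theorem ae_abs_coordError_le (hs : 1 ≤ s) (h : IsStochasticRounding s b v ξ P) {x : Fin n → ℝ}
    {M : ℝ} (hv : ∀ i, |v i| ≤ M) (hx : ∀ i, |x i| ≤ M) (i : Fin n) :
    ∀ᵐ ω ∂P, |coordError s b v x ξ i ω| ≤ 2 * M * M := by
  filter_upwards [h.ae_abs_sub_le i] with ω hω
  have hM : 0 ≤ M := (abs_nonneg _).trans (hv i)
  have hs' : (1 : ℝ) ≤ s := by exact_mod_cast hs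
  have hα : |scale b v i / s| ≤ 2 * M := by
    rw [abs_div, Nat.abs_cast]
    exact (div_le_self (abs_nonneg _) hs').trans (abs_scale_le b hv i)
  rw [coordError, abs_mul, abs_mul]
  calc _ ≤ 2 * M * M * 1 := by
        gcongr
        exact hx i
    _ = _ := mul_one _

omit [IsProbabilityMeasure P] in
theorem iIndepFun_coordError (h : IsStochasticRounding s b v ξ P) (x : Fin n → ℝ) :
    iIndepFun (coordError s b v x ξ) P :=
  h.indep.comp (fun i r => scale b v i / s * x i * (r - roundProb s (scaled b v i)))
    fun _ => by fun_prop

end UniformQuantization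

open UniformQuantization in
theorem mainTheorem1 {Ω : ℕ → Type*} [∀ n, MeasurableSpace (Ω n)]
    (P : ∀ n, Measure (Ω n)) [∀ n, IsProbabilityMeasure (P n)]
    (s : ℕ) (hs : 1 ≤ s) (b : ℕ → ℕ) (hb : ∀ n, 1 ≤ b n)
    (v x : ∀ n, Fin n → ℝ) (M : ℝ)
    (hv : ∀ n i, |v n i| ≤ M) (hx : ∀ n i, |x n i| ≤ M)
    (ξ : ∀ n, Fin n → Ω n → ℝ)
    (hξ : ∀ n, UniformQuantization.IsStochasticRounding s (b n) (v n) (ξ n) (P n))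
    (hlim : Tendsto (fun n => UniformQuantization.totalStd s (b n) (v n) (x n) (ξ n) (P n))
      atTop atTop) :
    ∃ ε : ∀ n, Ω n → ℝ,
      (∀ n ω, ∑ i, UniformQuantization.stochQuantize s (b n) (v n) (ξ n) i ω * x n i =
        ∑ i, v n i * x n i + ε n ω) ∧
      (∀ n, Integrable (ε n) (P n) ∧ ∫ ω, ε n ω ∂(P n) = 0) ∧
      TendstoInDistribution
        (fun n ω => 1 / UniformQuantization.totalStd s (b n) (v n) (x n) (ξ n) (P n) * ε n ω)
        atTop (id : ℝ → ℝ) P (gaussianReal 0 1) := by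
  refine ⟨fun n ω => ∑ i, coordError s (b n) (v n) (x n) (ξ n) i ω, fun n ω => ?_,
    fun n => ⟨?_, ?_⟩, ?_⟩
  · simp only [← stochQuantize_mul_sub hs, Finset.sum_sub_distrib]
    ring
  · exact integrable_finsetSum _ fun i _ => integrable_coordError (hξ n) (x n) i
  · rw [integral_finsetSum _ fun i _ => integrable_coordError (hξ n) (x n) i]
    exact Finset.sum_eq_zero fun i _ => integral_coordError (hξ n) (x n) i
  · have hstd : ∀ n, totalStd s (b n) (v n) (x n) (ξ n) (P n)
        = √(∑ i, Var[coordError s (b n) (v n) (x n) (ξ n) i; P n]) := fun n => by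
      simp only [totalStd, variance_coordError hs (hξ n)]
    simp only [hstd] at hlim ⊢
    exact tendstoInDistribution_sum_of_bounded
      (fun n i => aemeasurable_coordError (hξ n) (x n) i)
      (fun n => iIndepFun_coordError (hξ n) (x n))
      (fun n i => integral_coordError (hξ n) (x n) i)
      (fun n i => ae_abs_coordError_le hs (hξ n) (hv n) (hx n) i) hlim
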